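/- **Index coding.** An instance $\mathcal I(X,R)$ of the index coding problem consists of a finite set $X$ of messages and a set $R$ of clients $(x,H)$ with $x\in X$ and $H\subseteq X\setminus\{x\}$; the client $(x,H)$ demands $x$ and knows the messages in $H$. Let $\Sigma$ be an alphabet of size $q$ and let every message take values in $\Sigma^n$. An $(n,q)$ index code of length $c$ is a function $f:\Sigma^{n|X|}\to\Sigma^c$ such that for each client $\rho=(x,H)\in R$ there is a decoding function $\psi_\rho:\Sigma^{c+n|H|}\to\Sigma^n$ with $\psi_\rho\bigl(f(\xi),(\xi_h)_{h\in H}\bigr)=\xi_x$ for all $\xi\in\Sigma^{n|X|}$. It is linear if $\Sigma=\mathbb F_q$ and $f$ and all $\psi_\rho$ are $\mathbb F_q$-linear. Let $\lambda(n,q)$ be $\frac1n$ times the smallest length of an $(n,q)$ index code, let $\lambda^*(n,q)$ be $\frac1n$ times the smallest length of a linear one over $\mathbb F_q$, and let $\mu(\mathcal I)=\max_{Y\subseteq X}|\{x:(x,Y)\in R\}|$. **From networks to instances.** A coding network $\mathcal N$ is a finite directed acyclic graph with edge set $E\subseteq V\times V$ together with a surjection $\delta:D\to S$, where $S$ is the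 set of edges whose tail has in-degree $0$ (input edges, one message $x_s$ for each $s\in S$) and $D$ is the set of edges whose head has out-degree $0$ (output edges). Let $\mathcal P(e)$ be the set of edges that end at the tail of $e$. The instance $\mathcal I_{\mathcal N}$ has the messages $y_e$ ($e\in E$) and $x_s$ ($s\in S$), and the clients $(x_s,\{y_s\})$ and $(y_s,\{x_s\})$ for $s\in S$; $(y_e,\{y_{e'}:e'\in\mathcal P(e)\})$ for $e\in E\setminus S$; $(x_{\delta(e)},\{y_e\})$ for $e\in D$; and $(y_e,\{x_s:s\in S\})$ for $e\in E$. **The network $\mathcal N_3$ (Dougherty, Freiling, Zeger).** There are five messages $a,b,c,d,e$. The input edge of each message ends at a node from which the message can be forwarded. There are twelve coding edges, each leaving a node of its own, which receives what is listed in parentheses (a message, or the symbol of another coding edge): $w(a,b)$, $x(b,c)$, $y(a,x)$, $z(w,x)$; $p_{abc}(a,b,c)$, $p_{ab}(a,b)$, $p_{ac}(a,c)$, $p_{bc}(b,c)$; $q_{cde}(c,d,e)$, $q_{de}(d,e)$, $q_{cd}(c,d)$, $q_{ce}(c,e)$. There are ten receivers, each with one output edge that carries the demanded message; written as (received) $\to$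 demanded, they are $(w,y)\to c$, $(y,z)\to b$, $(z,c)\to a$; $(p_{abc},p_{ab})\to c$, $(p_{abc},p_{ac})\to b$, $(p_{abc},p_{bc})\to a$; $(q_{cde},q_{de})\to c$, $(q_{cde},q_{cd})\to e$, $(q_{cde},q_{ce})\to d$; and $(p_{ab},p_{ac},p_{bc},q_{de},q_{cd},q_{ce})\to c$. Every listed reception is a separate edge of unit capacity. **Corollary.** For the instance $\mathcal I_{\mathcal N_3}$ of the index coding problem, $$\lambda(2,4)=\mu(\mathcal I_{\mathcal N_3})<\lambda^*(2,4).$$ In particular, on this instance non-linear $(2,4)$ index codes achieve a strictly smaller rate than linear index codes of block length $2$ over $\mathbb F_4$. -/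

import Mathlib

namespace IndexCoding

/-! ### Index coding -/

/-- An instance of the index coding problem with message set `X`: a set of clients `(x, H)`,
where `x` is the demanded message and `H` (not containing `x`) is the side information. -/
structure Instance (X : Type*) where
  clients : Set (X × Set X)
  demand_notMem : ∀ ρ ∈ clients, ρ.1 ∉ ρ.2

namespace Instance

variable {X : Type*} (I : Instance X)

/-- `f` is an index code over the alphabet `A`, of block length `n` and length `c`: every client
recovers its message from the broadcast word and its side information. -/
def IsIndexCode (A : Type*) (n c : ℕ) (f : (X → Fin n → A) → (Fin c → A)) : Prop :=
  ∀ ρ ∈ I.clients, ∃ ψ : (Fin c → A) → (ρ.2 → Fin n → A) → (Fin n → A),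
    ∀ ξ : X → Fin n → A, ψ (f ξ) (fun h => ξ h) = ξ ρ.1

/-- `f` is a linear index code over the field `F`, of block length `n` and length `c`: the encoding
and all decoding functions are linear. -/
def IsLinearIndexCode (F : Type*) [Field F] (n c : ℕ)
    (f : (X → Fin n → F) →ₗ[F] (Fin c → F)) : Prop :=
  ∀ ρ ∈ I.clients, ∃ ψ : ((Fin c → F) × (ρ.2 → Fin n → F)) →ₗ[F] (Fin n → F),
    ∀ ξ : X → Fin n → F, ψ (f ξ, fun h => ξ h) = ξ ρ.1

/-- The smallest length of an index code of block length `n` over an alphabet of size `q`. -/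
noncomputable def minLength (n q : ℕ) : ℕ :=
  sInf {c | ∃ f, I.IsIndexCode (Fin q) n c f}

/-- The smallest length of a linear index code of block length `n` over the field `F`. -/
noncomputable def minLinearLength (n : ℕ) (F : Type*) [Field F] : ℕ :=
  sInf {c | ∃ f, I.IsLinearIndexCode F n c f}

/-- The optimal transmission rate `λ(n, q)`. -/
noncomputable def rate (n q : ℕ) : ℚ := (I.minLength n q : ℚ) / n

/-- The optimal vector linear transmission rate `λ*(n, q)`, where `F` is the field of `q`
elements. -/
noncomputable def linearRate (n : ℕ) (F : Type*) [Field F] : ℚ := (I.minLinearLength n F : ℚ) / n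

/-- The maximal number `μ` of messages requested by clients with identical side information. -/
noncomputable def mu [Finite X] : ℕ :=
  ⨆ Y : Set X, {x : X | (x, Y) ∈ I.clients}.ncard

end Instance

/-! ### Coding networks -/

section Network

variable {V : Type*}

/-- Edges whose tail node has no incoming edge. -/
def inputEdges (E : Set (V × V)) : Set (V × V) :=
  {e | e ∈ E ∧ ∀ e' ∈ E, e'.2 ≠ e.1}

/-- Edges whose head node has no outgoing edge. -/
def outputEdges (E : Set (V × V)) : Set (V × V) :=
  {e | e ∈ E ∧ ∀ e' ∈ E, e'.1 ≠ e.2}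

end Network

/-- A coding network: a finite directed acyclic graph, together with a demand function `δ` from the
output edges onto the input edges. There is one message for each input edge. -/
structure CodingNetwork (V : Type*) [Finite V] where
  E : Set (V × V)
  acyclic : ∀ v, ¬ Relation.TransGen (fun u w => (u, w) ∈ E) v v
  δ : outputEdges E → inputEdges E
  δ_surjective : Function.Surjective δ

namespace CodingNetwork

variable {V : Type*} [Finite V] (N : CodingNetwork V)

/-- The messages of the index coding instance of a network: a message `y e` for each edge and a
message `x s` for each input edge. -/
abbrev Message : Type _ := N.E ⊕ inputEdges N.E

/-- The message of an edge. -/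
abbrev y (e : N.E) : N.Message := Sum.inl e

/-- The message of an input edge that comes from the network. -/
abbrev x (s : inputEdges N.E) : N.Message := Sum.inr s

/-- The parent edges of an edge: those whose head is its tail. -/
def parents (e : N.E) : Set N.E := {e' | e'.1.2 = e.1.1}

/-- An input edge, as an edge. -/
def ofInput (s : inputEdges N.E) : N.E := ⟨s.1, s.2.1⟩

/-- An output edge, as an edge. -/
def ofOutput (t : outputEdges N.E) : N.E := ⟨t.1, t.2.1⟩

/-- The clients of the index coding instance of a network. -/
inductive IsClient : N.Message × Set N.Message → Prop
  | r₁ (s : inputEdges N.E) : IsClient (N.x s, {N.y (N.ofInput s)})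
  | r₂ (s : inputEdges N.E) : IsClient (N.y (N.ofInput s), {N.x s})
  | r₃ (e : N.E) (he : e.1 ∉ inputEdges N.E) : IsClient (N.y e, N.y '' N.parents e)
  | r₄ (t : outputEdges N.E) : IsClient (N.x (N.δ t), {N.y (N.ofOutput t)})
  | r₅ (e : N.E) : IsClient (N.y e, Set.range N.x)

/-- The index coding instance of a network. -/
def indexInstance : Instance N.Message where
  clients := {ρ | N.IsClient ρ}
  demand_notMem := by
    rintro _ (s | s | ⟨e, he⟩ | t | e)
    · simp
    · simp
    · rintro ⟨e', h, h'⟩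
      obtain rfl : e' = e := Sum.inl_injective h'
      refine N.acyclic e'.1.1 (.single ?_)
      have h' := e'.2
      rwa [show e'.1 = (e'.1.1, e'.1.1) from Prod.ext rfl h] at h'
    · simp
    · simp

end CodingNetwork

/-! ### The Dougherty–Freiling–Zeger network

Five messages `a, b, c, d, e`. The network consists of two parts which have only the sources in
common: a part of Fano type on `a, b, c`, and a part of non-Fano type with two blocks, on `a, b, c`
and on `c, d, e`, which share one last receiver. -/

namespace DFZ

inductive Msg
  | a | b | c | d | e
  deriving DecidableEq

instance : Fintype Msg where
  elems := {.a, .b, .c, .d, .e}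
  complete i := by cases i <;> decide

/-- The twelve coding edges (bottlenecks). `w, x, y, z` belong to the Fano part, the `p`'s to
the first and the `q`'s to the second block of the non-Fano part. -/
inductive Coder
  | w | x | y | z
  | pabc | pab | pac | pbc
  | qcde | qde | qcd | qce
  deriving DecidableEq

instance : Fintype Coder where
  elems := {.w, .x, .y, .z, .pabc, .pab, .pac, .pbc, .qcde, .qde, .qcd, .qce}
  complete i := by cases i <;> decide

/-- The ten receivers: three in the Fano part, three in each block of the non-Fano part, and the
last one. -/
inductive Receiver
  | f₁ | f₂ | f₃
  | p₁ | p₂ | p₃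
  | q₁ | q₂ | q₃
  | last
  deriving DecidableEq

instance : Fintype Receiver where
  elems := {.f₁, .f₂, .f₃, .p₁, .p₂, .p₃, .q₁, .q₂, .q₃, .last}
  complete i := by cases i <;> decide

/-- The messages that enter a coding edge directly. -/
def Coder.msgs : Coder → Finset Msg
  | .w => {.a, .b}
  | .x => {.b, .c}
  | .y => {.a}
  | .z => ∅
  | .pabc => {.a, .b, .c}
  | .pab => {.a, .b}
  | .pac => {.a, .c}
  | .pbc => {.b, .c}
  | .qcde => {.c, .d, .e}
  | .qde => {.d, .e}
  | .qcd => {.c, .d}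
  | .qce => {.c, .e}

/-- The coding edges that feed a coding edge. -/
def Coder.coders : Coder → Finset Coder
  | .y => {.x}
  | .z => {.w, .x}
  | _ => ∅

/-- The messages that a receiver gets directly. -/
def Receiver.msgs : Receiver → Finset Msg
  | .f₃ => {.c}
  | _ => ∅

/-- The coding edges that feed a receiver. -/
def Receiver.coders : Receiver → Finset Coder
  | .f₁ => {.w, .y}
  | .f₂ => {.y, .z}
  | .f₃ => {.z}
  | .p₁ => {.pabc, .pab}
  | .p₂ => {.pabc, .pac}
  | .p₃ => {.pabc, .pbc}
  | .q₁ => {.qcde, .qde}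
  | .q₂ => {.qcde, .qcd}
  | .q₃ => {.qcde, .qce}
  | .last => {.pab, .pac, .pbc, .qde, .qcd, .qce}

/-- The message demanded by a receiver. -/
def Receiver.demand : Receiver → Msg
  | .f₁ => .c
  | .f₂ => .b
  | .f₃ => .a
  | .p₁ => .c
  | .p₂ => .b
  | .p₃ => .a
  | .q₁ => .c
  | .q₂ => .e
  | .q₃ => .d
  | .last => .c

/-- The nodes. The input edge of message `m` is `src m → hub m`, the coding edge `k` is
`enter k → leave k`, and the output edge of receiver `r` is `rcv r → sink r`. -/
inductive Node
  | src (m : Msg)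
  | hub (m : Msg)
  | enter (k : Coder)
  | leave (k : Coder)
  | rcv (r : Receiver)
  | sink (r : Receiver)
  deriving DecidableEq

instance : Fintype Node where
  elems := Finset.univ.image .src ∪ Finset.univ.image .hub ∪ Finset.univ.image .enter ∪
    Finset.univ.image .leave ∪ Finset.univ.image .rcv ∪ Finset.univ.image .sink
  complete v := by cases v <;> simp

/-- The edges, as a Boolean relation. -/
def adj : Node → Node → Bool
  | .src m, .hub m' => m = m'
  | .hub m, .enter k => m ∈ k.msgs
  | .leave k', .enter k => k' ∈ k.coders
  | .enter k, .leave k' => k = k'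
  | .hub m, .rcv r => m ∈ r.msgs
  | .leave k, .rcv r => k ∈ r.coders
  | .rcv r, .sink r' => r = r'
  | _, _ => false

/-- The set of edges. -/
def edges : Set (Node × Node) := {p | adj p.1 p.2 = true}

theorem mem_edges (u v : Node) : (u, v) ∈ edges ↔ adj u v = true := Iff.rfl

/-- A topological order of the nodes. -/
def level : Node → ℕ
  | .src _ => 0
  | .hub _ => 1
  | .enter k => if k.coders = ∅ then 2 else 4
  | .leave k => if k.coders = ∅ then 3 else 5
  | .rcv _ => 6
  | .sink _ => 7

theorem level_lt {u v : Node} (h : (u, v) ∈ edges) : level u < level v := by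
  rw [mem_edges] at h
  revert h
  cases u <;> cases v <;> rename_i i j <;> first | (simp [adj]; done) | (revert i j; decide)

theorem input_mem (m : Msg) : (Node.src m, Node.hub m) ∈ inputEdges edges := by
  refine ⟨(mem_edges _ _).2 (by simp [adj]), ?_⟩
  intro p h hv
  have h' := (mem_edges p.1 p.2).1 h
  rw [hv] at h'
  cases hu : p.1 <;> simp [adj, hu] at h'

theorem output_mem (r : Receiver) : (Node.rcv r, Node.sink r) ∈ outputEdges edges := by
  refine ⟨(mem_edges _ _).2 (by simp [adj]), ?_⟩
  intro p h hu
  have h' := (mem_edges p.1 p.2).1 h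
  rw [hu] at h'
  cases hv : p.2 <;> simp [adj] at h'

/-- The message demanded at the tail of an output edge. All output edges start at a receiver, so
the value at the other nodes is irrelevant. -/
def demandAt : Node → Msg
  | .rcv r => r.demand
  | _ => .c

/-- The Dougherty–Freiling–Zeger network. -/
def network : CodingNetwork Node where
  E := edges
  acyclic v h := by
    have key : ∀ w, Relation.TransGen (fun u w => (u, w) ∈ edges) v w → level v < level w := by
      intro w hw
      induction hw with
      | single h => exact level_lt h
      | tail _ h ih => exact ih.trans (level_lt h)
    exact lt_irrefl _ (key v h)
  δ t := ⟨(.src (demandAt t.1.1), .hub (demandAt t.1.1)), input_mem _⟩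
  δ_surjective := by
    rintro ⟨⟨u, v⟩, h⟩
    have h1 := (mem_edges u v).1 h.1
    have h2 := h.2
    have hm : ∀ m : Msg, (Node.src m, Node.hub m) ∈ edges := fun m =>
      (mem_edges _ _).2 (by simp [adj])
    have hk : ∀ k : Coder, (Node.enter k, Node.leave k) ∈ edges := fun k =>
      (mem_edges _ _).2 (by simp [adj])
    have hl : ∀ k : Coder, ∃ m, (Node.hub m, Node.enter k) ∈ edges ∨
        ∃ k', (Node.leave k', Node.enter k) ∈ edges := by
      simp only [mem_edges]; decide
    have hr : ∀ r : Receiver, ∃ k, (Node.leave k, Node.rcv r) ∈ edges := by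
      simp only [mem_edges]; decide
    cases u with
    | src m =>
      cases v with
      | hub m' =>
        have : m = m' := by simpa [adj] using h1
        subst this
        have hd : ∀ m : Msg, ∃ r : Receiver, r.demand = m := by decide
        obtain ⟨r, rfl⟩ := hd m
        exact ⟨⟨_, output_mem r⟩, rfl⟩
      | _ => simp [adj] at h1
    | hub m => exact absurd rfl (h2 _ (hm m))
    | enter k =>
      obtain ⟨m, h | ⟨k', h⟩⟩ := hl k
      · exact absurd rfl (h2 _ h)
      · exact absurd rfl (h2 _ h)
    | leave k => exact absurd rfl (h2 _ (hk k))
    | rcv r =>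
      obtain ⟨k, h⟩ := hr r
      exact absurd rfl (h2 _ h)
    | sink r => cases v <;> simp [adj] at h1

end DFZ

end IndexCoding

/-!
An index code of block length `n` for the instance of a network with edge set `E` has length at
least `n * |E|`, because the clients that know all the `x s` demand every `y e`. Length exactly
`n * |E|` amounts to a network code: from the latter, broadcast `y e - φ e x` for every edge `e`;
conversely, the kernel of a linear index code of that length projects isomorphically onto the
messages `x`, and its other coordinates form a linear network code.

The Dougherty–Freiling–Zeger network has a network code over four symbols, read as `(ℤ/2)²` on the
Fano part and as `ℤ/4` on the non-Fano part. The last receiver gets `2 * c` from the first block;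
since the second block uses `c` with its two digits exchanged, the receiver also learns the digit
that doubling destroys. Linear codes have no such freedom: in characteristic two, every value of
`c` extends to messages for which all pairwise symbols of both blocks vanish.
-/

namespace IndexCoding

namespace Instance

variable {X : Type*} {I : Instance X} {n c : ℕ}

theorem isIndexCode_iff {A : Type*} [Nonempty A] {f : (X → Fin n → A) → (Fin c → A)} :
    I.IsIndexCode A n c f ↔ ∀ ρ ∈ I.clients, ∀ ξ ξ' : X → Fin n → A, f ξ = f ξ' →
      (∀ i ∈ ρ.2, ξ i = ξ' i) → ξ ρ.1 = ξ' ρ.1 := by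
  refine forall₂_congr fun ρ _ => ⟨fun ⟨ψ, hψ⟩ ξ ξ' hf h => ?_, fun h => ?_⟩
  · have hside : (fun i : ρ.2 => ξ i) = fun i : ρ.2 => ξ' i := funext fun i => h i i.2
    rw [← hψ ξ, ← hψ ξ', hf, hside]
  · have hfactors : Function.FactorsThrough (fun ξ : X → Fin n → A => ξ ρ.1)
        fun ξ => (f ξ, fun i : ρ.2 => ξ i) := fun ξ ξ' hξ =>
      h ξ ξ' (congrArg Prod.fst hξ) fun i hi => congrFun (congrArg Prod.snd hξ) ⟨i, hi⟩
    obtain ⟨ψ, hψ⟩ := (Function.factorsThrough_iff _).1 hfactors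
    exact ⟨fun u w => ψ (u, w), fun ξ => (congrFun hψ ξ).symm⟩

theorem IsIndexCode.mul_ncard_le [Finite X] {A : Type*} [Finite A] [Nontrivial A]
    {f : (X → Fin n → A) → (Fin c → A)} (hf : I.IsIndexCode A n c f) (Y : Set X) :
    n * {x : X | (x, Y) ∈ I.clients}.ncard ≤ c := by
  let T := {x : X | (x, Y) ∈ I.clients}
  let a₀ : A := Classical.arbitrary A
  let extend (v : T → Fin n → A) : X → Fin n → A := Function.extend Subtype.val v fun _ _ => a₀
  have extend_of_mem (v) (x : T) : extend v x = v x := Subtype.val_injective.extend_apply v _ x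
  have extend_of_side (v) {i} (hi : i ∈ Y) : extend v i = fun _ => a₀ :=
    Function.extend_apply' _ _ _ fun ⟨x, hx⟩ => I.demand_notMem _ x.2 (hx ▸ hi)
  have hinj : Function.Injective (f ∘ extend) := fun v v' hv => funext fun x => by
    rw [← extend_of_mem v, ← extend_of_mem v']
    exact isIndexCode_iff.1 hf _ x.2 _ _ hv fun i hi => by
      rw [extend_of_side v hi, extend_of_side v' hi]
  have hcard := Nat.card_le_card_of_injective _ hinj
  simp only [Nat.card_fun, Nat.card_fin, ← pow_mul, Nat.card_coe_set_eq] at hcard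
  exact (Nat.pow_le_pow_iff_right Finite.one_lt_card).1 hcard

theorem IsIndexCode.mul_mu_le [Finite X] {A : Type*} [Finite A] [Nontrivial A]
    {f : (X → Fin n → A) → (Fin c → A)} (hf : I.IsIndexCode A n c f) : n * I.mu ≤ c := by
  obtain ⟨Y, hY⟩ := exists_eq_ciSup_of_finite
    (f := fun Y : Set X => {x : X | (x, Y) ∈ I.clients}.ncard)
  rw [mu, ← hY]
  exact hf.mul_ncard_le Y

theorem ncard_le_mu [Finite X] (Y : Set X) : {x : X | (x, Y) ∈ I.clients}.ncard ≤ I.mu :=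
  le_ciSup (f := fun Y : Set X => {x : X | (x, Y) ∈ I.clients}.ncard)
    (Set.finite_range _).bddAbove Y

variable {F : Type*} [Field F]

theorem IsLinearIndexCode.apply_eq_zero {f : (X → Fin n → F) →ₗ[F] (Fin c → F)}
    (hf : I.IsLinearIndexCode F n c f) {ρ : X × Set X} (hρ : ρ ∈ I.clients) {ξ : X → Fin n → F}
    (hξ : f ξ = 0) (h : ∀ i ∈ ρ.2, ξ i = 0) : ξ ρ.1 = 0 := by
  obtain ⟨ψ, hψ⟩ := hf ρ hρ
  have hside : (fun i : ρ.2 => ξ i) = 0 := funext fun i => h i i.2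
  rw [← hψ ξ, hξ, hside]
  exact map_zero ψ

variable (I F n) in
theorem exists_isLinearIndexCode [Finite X] : ∃ c f, I.IsLinearIndexCode F n c f := by
  let L := (Module.finBasis F (X → Fin n → F)).equivFun
  exact ⟨_, L.toLinearMap, fun ρ _ =>
    ⟨LinearMap.proj ρ.1 ∘ₗ L.symm.toLinearMap ∘ₗ LinearMap.fst F _ _, fun ξ => by simp⟩⟩

end Instance

namespace CodingNetwork

variable {V : Type*} [Finite V] {N : CodingNetwork V}

/-- A network code over the alphabet `A` that satisfies all demands, given by the symbol `φ e v`
carried by the edge `e` when the messages are `v`. Coding and decoding functions are encoded as the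
statement that one value determines another. Accordingly an input edge may carry any relabelling
of its message, and an output edge need only determine the demanded message. -/
structure IsNetworkCode {A : Type*} (N : CodingNetwork V)
    (φ : N.E → (inputEdges N.E → A) → A) : Prop where
  input : ∀ s v v', φ (N.ofInput s) v = φ (N.ofInput s) v' ↔ v s = v' s
  coding : ∀ e : N.E, e.1 ∉ inputEdges N.E → ∀ v v',
    (∀ e' ∈ N.parents e, φ e' v = φ e' v') → φ e v = φ e v'
  output : ∀ t v v', φ (N.ofOutput t) v = φ (N.ofOutput t) v' → v (N.δ t) = v' (N.δ t)

theorem IsNetworkCode.pi {A ι : Type*} {φ : N.E → (inputEdges N.E → A) → A}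
    (hφ : N.IsNetworkCode φ) :
    N.IsNetworkCode fun e (v : inputEdges N.E → ι → A) j => φ e fun s => v s j where
  input s v v' := by simp only [funext_iff, hφ.input]
  coding e he v v' h := funext fun j => hφ.coding e he _ _ fun e' he' => congrFun (h e' he') j
  output t v v' h := funext fun j => hφ.output t _ _ (congrFun h j)

variable (N) in
theorem card_edges_le_mu : Nat.card N.E ≤ N.indexInstance.mu := calc
  Nat.card N.E = (Set.range N.y).ncard :=
    (Set.ncard_range_of_injective Sum.inl_injective).symm
  _ ≤ {i : N.Message | (i, Set.range N.x) ∈ N.indexInstance.clients}.ncard :=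
    Set.ncard_le_ncard (Set.range_subset_iff.2 IsClient.r₅) (Set.toFinite _)
  _ ≤ N.indexInstance.mu := Instance.ncard_le_mu _

/-- The word broadcast by the index code of a network code: the message of each edge, masked by
the symbol that the network code puts on that edge. -/
def broadcast {B : Type*} [Sub B] (φ : N.E → (inputEdges N.E → B) → B) (ξ : N.Message → B) :
    N.E → B :=
  fun e => ξ (N.y e) - φ e fun s => ξ (N.x s)

theorem IsNetworkCode.eq_of_broadcast_eq {B : Type*} [AddGroup B]
    {φ : N.E → (inputEdges N.E → B) → B} (hφ : N.IsNetworkCode φ) {ξ ξ' : N.Message → B}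
    (hξ : broadcast φ ξ = broadcast φ ξ') {ρ : N.Message × Set N.Message} (hρ : N.IsClient ρ)
    (h : ∀ i ∈ ρ.2, ξ i = ξ' i) : ξ ρ.1 = ξ' ρ.1 := by
  have masked_eq_iff (e : N.E) : ξ (N.y e) = ξ' (N.y e) ↔
      (φ e fun s => ξ (N.x s)) = φ e fun s => ξ' (N.x s) := by
    have he : ξ (N.y e) - _ = ξ' (N.y e) - _ := congrFun hξ e
    constructor <;> intro heq <;> rw [heq] at he
    · exact sub_right_injective he
    · exact sub_left_injective he
  cases hρ with
  | r₁ s => exact (hφ.input s _ _).1 ((masked_eq_iff _).1 (h _ rfl))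
  | r₂ s => exact (masked_eq_iff _).2 ((hφ.input s _ _).2 (h _ rfl))
  | r₃ e he =>
    exact (masked_eq_iff e).2 <| hφ.coding e he _ _ fun e' he' =>
      (masked_eq_iff e').1 (h _ ⟨e', he', rfl⟩)
  | r₄ t => exact hφ.output t _ _ ((masked_eq_iff _).1 (h _ rfl))
  | r₅ e => exact (masked_eq_iff e).2 (congrArg (φ e) (funext fun s => h _ ⟨s, rfl⟩))

section Nonlinear

variable {A : Type*} [AddGroup A] {n : ℕ} {φ : N.E → (inputEdges N.E → Fin n → A) → Fin n → A}

theorem IsNetworkCode.exists_isIndexCode (hφ : N.IsNetworkCode φ) :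
    ∃ f, N.indexInstance.IsIndexCode A n (n * Nat.card N.E) f := by
  have hcard : Nat.card (N.E × Fin n) = n * Nat.card N.E := by simp [mul_comm]
  let flatten : (N.E → Fin n → A) ≃ (Fin (n * Nat.card N.E) → A) :=
    (Equiv.curry N.E (Fin n) A).symm.trans
      ((Finite.equivFinOfCardEq hcard).arrowCongr (Equiv.refl A))
  exact ⟨flatten ∘ broadcast φ, Instance.isIndexCode_iff.2 fun ρ hρ ξ ξ' hξ h =>
    hφ.eq_of_broadcast_eq (flatten.injective hξ) hρ h⟩

theorem IsNetworkCode.mu_eq_card_edges [Finite A] [Nontrivial A] (hn : 0 < n)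
    (hφ : N.IsNetworkCode φ) : N.indexInstance.mu = Nat.card N.E := by
  obtain ⟨f, hf⟩ := hφ.exists_isIndexCode
  exact le_antisymm (le_of_mul_le_mul_left hf.mul_mu_le hn) N.card_edges_le_mu

end Nonlinear

theorem IsNetworkCode.rate_eq_mu {n q : ℕ} [NeZero q] [Nontrivial (Fin q)] (hn : 0 < n)
    {φ : N.E → (inputEdges N.E → Fin n → Fin q) → Fin n → Fin q} (hφ : N.IsNetworkCode φ) :
    N.indexInstance.rate n q = N.indexInstance.mu := by
  have hmin : N.indexInstance.minLength n q = n * N.indexInstance.mu := by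
    have hexists : ∃ f, N.indexInstance.IsIndexCode (Fin q) n (n * N.indexInstance.mu) f :=
      hφ.mu_eq_card_edges hn ▸ hφ.exists_isIndexCode
    obtain ⟨f, hf⟩ := Nat.sInf_mem (s := {c | ∃ f, N.indexInstance.IsIndexCode (Fin q) n c f})
      ⟨_, hexists⟩
    exact le_antisymm (Nat.sInf_le hexists) hf.mul_mu_le
  rw [Instance.rate, hmin, Nat.cast_mul, mul_div_cancel_left₀ _ (Nat.cast_ne_zero.2 hn.ne')]

section Linear

variable {F : Type*} [Field F] {n c : ℕ} {f : (N.Message → Fin n → F) →ₗ[F] (Fin c → F)}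

theorem le_finrank_ker (hc : c ≤ n * Nat.card N.E) :
    Module.finrank F (inputEdges N.E → Fin n → F) ≤ Module.finrank F (LinearMap.ker f) := by
  have := Fintype.ofFinite N.E
  have := Fintype.ofFinite (inputEdges N.E)
  have hrange : Module.finrank F (LinearMap.range f) ≤ c := by
    simpa using (LinearMap.range f).finrank_le
  have hsum := f.finrank_range_add_finrank_ker
  simp only [Module.finrank_pi_fintype, Module.finrank_self, Finset.sum_const, Finset.card_univ,
    Fintype.card_sum, Fintype.card_fin, smul_eq_mul, mul_one, Nat.card_eq_fintype_card]
    at hsum hc ⊢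
  linarith [mul_comm n (Fintype.card N.E)]

theorem bijective_ker_restrict_input (hf : N.indexInstance.IsLinearIndexCode F n c f)
    (hc : c ≤ n * Nat.card N.E) :
    Function.Bijective (LinearMap.funLeft F (Fin n → F) N.x ∘ₗ (LinearMap.ker f).subtype) := by
  set π := LinearMap.funLeft F (Fin n → F) N.x ∘ₗ (LinearMap.ker f).subtype
  have hinj : Function.Injective π := (injective_iff_map_eq_zero π).2 fun ξ hξ => by
    have hx (s) : ξ.1 (N.x s) = 0 := congrFun hξ s
    refine Subtype.ext (funext fun i => ?_)
    cases i with
    | inl e => exact hf.apply_eq_zero (.r₅ e) ξ.2 (Set.forall_mem_range.2 hx)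
    | inr s => exact hx s
  exact ⟨hinj, (LinearMap.injective_iff_surjective_of_finrank_eq_finrank
    ((LinearMap.finrank_le_finrank_of_injective hinj).antisymm (le_finrank_ker hc))).1 hinj⟩

theorem exists_linear_isNetworkCode (hf : N.indexInstance.IsLinearIndexCode F n c f)
    (hc : c ≤ n * Nat.card N.E) :
    ∃ φ : N.E → (inputEdges N.E → Fin n → F) →ₗ[F] (Fin n → F),
      N.IsNetworkCode fun e => φ e := by
  let lift := (LinearEquiv.ofBijective _ (bijective_ker_restrict_input hf hc)).symm
  have lift_x (v s) : (lift v).1 (N.x s) = v s :=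
    congrFun ((LinearEquiv.ofBijective _ (bijective_ker_restrict_input hf hc)).apply_symm_apply v) s
  have determined {ρ} (hρ : N.IsClient ρ) (v v')
      (h : ∀ i ∈ ρ.2, (lift v).1 i = (lift v').1 i) : (lift v).1 ρ.1 = (lift v').1 ρ.1 :=
    sub_eq_zero.1 <| hf.apply_eq_zero hρ (sub_mem (lift v).2 (lift v').2) fun i hi =>
      sub_eq_zero.2 (h i hi)
  refine ⟨fun e => LinearMap.proj (N.y e) ∘ₗ (LinearMap.ker f).subtype ∘ₗ lift.toLinearMap,
    fun s v v' => ⟨fun h => ?_, fun h => ?_⟩, fun e he v v' h => ?_, fun t v v' h => ?_⟩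
  · rw [← lift_x v, ← lift_x v']
    exact determined (.r₁ s) v v' fun _ hi => hi ▸ h
  · rw [← lift_x v, ← lift_x v'] at h
    exact determined (.r₂ s) v v' fun _ hi => hi ▸ h
  · exact determined (.r₃ e he) v v' (Set.forall_mem_image.2 h)
  · rw [← lift_x v, ← lift_x v']
    exact determined (.r₄ t) v v' fun _ hi => hi ▸ h

theorem card_edges_lt_linearRate (hn : 0 < n)
    (h : ∀ φ : N.E → (inputEdges N.E → Fin n → F) →ₗ[F] (Fin n → F),
      ¬ N.IsNetworkCode fun e => φ e) :
    (Nat.card N.E : ℚ) < N.indexInstance.linearRate n F := by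
  obtain ⟨f, hf⟩ := Nat.sInf_mem (s := {c | ∃ f, N.indexInstance.IsLinearIndexCode F n c f})
    (N.indexInstance.exists_isLinearIndexCode n F)
  have hlt : n * Nat.card N.E < N.indexInstance.minLinearLength n F := by
    by_contra! hle
    obtain ⟨φ, hφ⟩ := exists_linear_isNetworkCode hf hle
    exact h φ hφ
  rw [Instance.linearRate, lt_div_iff₀' (Nat.cast_pos.2 hn)]
  exact_mod_cast hlt

end Linear

end CodingNetwork

/-! ### Blocks of non-Fano type -/

section Block

variable {K W ι : Type*} [DivisionRing K] [AddCommGroup W] [Module K W] [DecidableEq ι]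

theorem map_eq_sum_single_of_dependsOn {φ : (ι → W) →ₗ[K] W} {S : Finset ι}
    (hφ : DependsOn φ (S : Set ι)) (v : ι → W) : φ v = ∑ i ∈ S, φ (Pi.single i (v i)) := by
  rw [← map_sum]
  refine hφ fun i hi => ?_
  rw [Finset.sum_apply, Finset.sum_pi_single, if_pos (Finset.mem_coe.1 hi)]

variable {φ ψ : (ι → W) →ₗ[K] W} {i : ι}

theorem map_single_surjective [FiniteDimensional K W] (hψ : ∀ w, ψ (Pi.single i w) = 0)
    (hdec : ∀ v, φ v = 0 → ψ v = 0 → v i = 0) : Function.Surjective fun w => φ (Pi.single i w) := by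
  have hinj : Function.Injective (φ ∘ₗ LinearMap.single K (fun _ => W) i) :=
    (injective_iff_map_eq_zero _).2 fun w hw => by simpa using hdec (Pi.single i w) hw (hψ w)
  exact LinearMap.surjective_of_injective hinj

theorem map_eq_map_single_of_eq_zero [FiniteDimensional K W] (hψ : ∀ w, ψ (Pi.single i w) = 0)
    (hdec : ∀ v, φ v = 0 → ψ v = 0 → v i = 0) {v : ι → W} (hv : ψ v = 0) :
    φ v = φ (Pi.single i (v i)) := by
  obtain ⟨w, hw : φ (Pi.single i w) = φ v⟩ := map_single_surjective hψ hdec (φ v)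
  have hvw : v i - Pi.single (M := fun _ => W) i w i = 0 :=
    hdec (v - Pi.single i w) (by rw [map_sub, hw, sub_self]) (by rw [map_sub, hv, hψ, sub_self])
  rw [sub_eq_zero.1 hvw, Pi.single_eq_same, hw]

-- `ker ψ ≤ ker (v ↦ φ v - φ (Pi.single i (v i)))`, and the second map is onto, so that
-- the kernels agree.
theorem eq_zero_iff_map_eq_map_single [FiniteDimensional K W] [Finite ι] {j : ι} (hij : i ≠ j)
    (hψ : ∀ w, ψ (Pi.single i w) = 0) (hdec : ∀ v, φ v = 0 → ψ v = 0 → v i = 0)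
    (hj : Function.Surjective fun w => φ (Pi.single j w)) {v : ι → W} :
    ψ v = 0 ↔ φ v = φ (Pi.single i (v i)) := by
  let χ : (ι → W) →ₗ[K] W := φ - φ ∘ₗ LinearMap.single K (fun _ => W) i ∘ₗ LinearMap.proj i
  have mem_ker_χ {v} : v ∈ LinearMap.ker χ ↔ φ v = φ (Pi.single i (v i)) := sub_eq_zero
  have hle : LinearMap.ker ψ ≤ LinearMap.ker χ := fun v hv =>
    mem_ker_χ.2 (map_eq_map_single_of_eq_zero hψ hdec hv)
  have hχ : LinearMap.range χ = ⊤ := LinearMap.range_eq_top.2 fun w => by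
    obtain ⟨u, rfl⟩ := hj w
    exact ⟨Pi.single j u, by simp [χ, hij]⟩
  have hfinrank : Module.finrank K (LinearMap.ker χ) ≤ Module.finrank K (LinearMap.ker ψ) := by
    have hχ_sum := χ.finrank_range_add_finrank_ker
    have hψ_sum := ψ.finrank_range_add_finrank_ker
    rw [hχ, finrank_top] at hχ_sum
    have := (LinearMap.range ψ).finrank_le
    omega
  rw [← mem_ker_χ, ← Submodule.eq_of_le_of_finrank_le hle hfinrank, LinearMap.mem_ker]

theorem exists_apply_eq_forall_eq_zero [FiniteDimensional K W] [Finite ι] {S : Finset ι}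
    (hcard : (S.card : K) = 1) (hS : S.Nontrivial) {ψ : ι → (ι → W) →ₗ[K] W}
    (hφ : DependsOn φ (S : Set ι)) (hψ : ∀ i ∈ S, ∀ w, ψ i (Pi.single i w) = 0)
    (hdec : ∀ i ∈ S, ∀ v, φ v = 0 → ψ i v = 0 → v i = 0) (i₀ : ι) (w : W) :
    ∃ v : ι → W, v i₀ = w ∧ ∀ i ∈ S, ψ i v = 0 := by
  have hsurj (i) (hi : i ∈ S) := map_single_surjective (hψ i hi) (hdec i hi)
  let u := φ (Pi.single i₀ w)
  choose! x hx using fun i hi => hsurj i hi u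
  let v := Function.update x i₀ w
  have hv (i) (hi : i ∈ S) : φ (Pi.single i (v i)) = u := by
    obtain rfl | hne := eq_or_ne i i₀
    · simp only [v, u, Function.update_self]
    · simpa only [v, Function.update_of_ne hne] using hx i hi
  have hφv : φ v = u := calc
    φ v = ∑ i ∈ S, φ (Pi.single i (v i)) := map_eq_sum_single_of_dependsOn hφ v
    _ = (S.card : K) • u := by
      rw [Finset.sum_congr rfl hv, Finset.sum_const, Nat.cast_smul_eq_nsmul]
    _ = u := by rw [hcard, one_smul]
  refine ⟨v, Function.update_self .., fun i hi => ?_⟩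
  obtain ⟨j, hj, hji⟩ := hS.exists_ne i
  exact (eq_zero_iff_map_eq_map_single hji.symm (hψ i hi) (hdec i hi) (hsurj j hj)).2
    (hφv.trans (hv i hi).symm)

end Block

namespace DFZ

variable {A : Type*}

/-! ### Network codes in terms of coding edges and receivers -/

/-- The input edge of a message. -/
def inputEdge (m : Msg) : inputEdges network.E := ⟨(.src m, .hub m), input_mem m⟩

/-- The coding edge of the network that a `Coder` stands for. -/
def coderEdge (k : Coder) : network.E :=
  ⟨(.enter k, .leave k), (mem_edges _ _).2 (by simp [adj])⟩

/-- The output edge of a receiver. -/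
def outputEdge (r : Receiver) : outputEdges network.E := ⟨(.rcv r, .sink r), output_mem r⟩

theorem inputEdge_bijective : Function.Bijective inputEdge := by
  refine ⟨fun m m' h => Node.src.inj (congrArg (fun s : inputEdges network.E => s.1.1) h),
    fun s => ?_⟩
  obtain ⟨t, rfl⟩ := network.δ_surjective s
  exact ⟨_, rfl⟩

/-- The messages are indexed by the input edges. -/
noncomputable def inputEquiv : Msg ≃ inputEdges network.E :=
  Equiv.ofBijective inputEdge inputEdge_bijective

theorem inputEquiv_symm_inputEdge (m : Msg) : inputEquiv.symm (inputEdge m) = m :=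
  inputEquiv.symm_apply_apply m

theorem exists_adj_or_eq_sink (u : Node) : (∃ w, adj u w = true) ∨ ∃ r, u = .sink r := by
  have exists_mem_msgs : ∀ m, ∃ k : Coder, m ∈ k.msgs := by decide
  have exists_mem_coders : ∀ k, (∃ k' : Coder, k ∈ k'.coders) ∨ ∃ r : Receiver, k ∈ r.coders := by
    decide
  cases u with
  | src m => exact .inl ⟨.hub m, by simp [adj]⟩
  | hub m =>
    obtain ⟨k, hk⟩ := exists_mem_msgs m
    exact .inl ⟨.enter k, by simpa [adj] using hk⟩
  | enter k => exact .inl ⟨.leave k, by simp [adj]⟩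
  | leave k =>
    obtain ⟨k', hk⟩ | ⟨r, hk⟩ := exists_mem_coders k
    · exact .inl ⟨.enter k', by simpa [adj] using hk⟩
    · exact .inl ⟨.rcv r, by simpa [adj] using hk⟩
  | rcv r => exact .inl ⟨.sink r, by simp [adj]⟩
  | sink r => exact .inr ⟨r, rfl⟩

theorem outputEdge_surjective : Function.Surjective outputEdge := by
  rintro ⟨⟨u, w⟩, hE, hout⟩
  obtain ⟨w', hw'⟩ | ⟨r, rfl⟩ := exists_adj_or_eq_sink w
  · exact absurd rfl (hout (w, w') hw')
  · have hadj := (mem_edges _ _).1 hE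
    cases u with
    | rcv r' =>
      obtain rfl : r' = r := by simpa [adj] using hadj
      exact ⟨r', rfl⟩
    | _ => simp [adj] at hadj

/-- A network code on the Dougherty–Freiling–Zeger network, reduced to the symbols `σ k v` of the
coding edges when the messages are `v`. -/
structure IsCoderCode (σ : Coder → (Msg → A) → A) : Prop where
  coding : ∀ k v v', (∀ m ∈ k.msgs, v m = v' m) → (∀ k' ∈ k.coders, σ k' v = σ k' v') →
    σ k v = σ k v'
  decoding : ∀ (r : Receiver) v v', (∀ m ∈ r.msgs, v m = v' m) →
    (∀ k ∈ r.coders, σ k v = σ k v') → v r.demand = v' r.demand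

/-- The symbol sent along all edges that leave a node. No edge leaves a `sink`, where the value is
irrelevant. -/
def nodeSymbol (σ : Coder → (Msg → A) → A) (v : Msg → A) : Node → A
  | .src m | .hub m => v m
  | .enter k | .leave k => σ k v
  | .rcv r | .sink r => v r.demand

theorem IsCoderCode.nodeSymbol_eq {σ : Coder → (Msg → A) → A} (hσ : IsCoderCode σ) {u w : Node}
    (he : (u, w) ∈ edges) (hu : ∀ m, u ≠ .src m) {v v' : Msg → A}
    (h : ∀ t, (t, u) ∈ edges → nodeSymbol σ v t = nodeSymbol σ v' t) :
    nodeSymbol σ v u = nodeSymbol σ v' u := by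
  cases u with
  | src m => exact absurd rfl (hu m)
  | hub m => exact h (.src m) (by simp [mem_edges, adj])
  | enter k =>
    exact hσ.coding k v v' (fun m hm => h (.hub m) (by simpa [mem_edges, adj] using hm))
      fun k' hk' => h (.leave k') (by simpa [mem_edges, adj] using hk')
  | leave k => exact h (.enter k) (by simp [mem_edges, adj])
  | rcv r =>
    exact hσ.decoding r v v' (fun m hm => h (.hub m) (by simpa [mem_edges, adj] using hm))
      fun k hk => h (.leave k) (by simpa [mem_edges, adj] using hk)
  | sink r => cases w <;> simp [mem_edges, adj] at he

theorem mem_inputEdges_of_src {m : Msg} {w : Node} (h : (Node.src m, w) ∈ edges) :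
    (Node.src m, w) ∈ inputEdges edges := by
  have hadj := (mem_edges _ _).1 h
  cases w with
  | hub m' =>
    obtain rfl : m = m' := by simpa [adj] using hadj
    exact input_mem m
  | _ => simp [adj] at hadj

theorem IsCoderCode.isNetworkCode {σ : Coder → (Msg → A) → A} (hσ : IsCoderCode σ) :
    network.IsNetworkCode fun e v => nodeSymbol σ (v ∘ inputEdge) e.1.1 where
  input s v v' := by
    obtain ⟨m, rfl⟩ := inputEdge_bijective.surjective s
    exact Iff.rfl
  coding := by
    rintro ⟨⟨u, w⟩, he⟩ hin v v' h
    exact hσ.nodeSymbol_eq he (fun m hm => hin (by subst hm; exact mem_inputEdges_of_src he))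
      fun t ht => h ⟨(t, u), ht⟩ rfl
  output t v v' h := by
    obtain ⟨r, rfl⟩ := outputEdge_surjective t
    exact h

section OfNetworkCode

variable {φ : network.E → (inputEdges network.E → A) → A} {v v' : inputEdges network.E → A}

theorem apply_eq_of_parents (hφ : network.IsNetworkCode φ) {u w : Node}
    (he : (u, w) ∈ network.E) (hu : ∀ m, u ≠ .src m)
    (h : ∀ t (ht : (t, u) ∈ network.E), φ ⟨(t, u), ht⟩ v = φ ⟨(t, u), ht⟩ v') :
    φ ⟨(u, w), he⟩ v = φ ⟨(u, w), he⟩ v' := by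
  refine hφ.coding ⟨(u, w), he⟩ (fun hin => ?_) v v' ?_
  · obtain ⟨m, hm⟩ := inputEdge_bijective.surjective ⟨_, hin⟩
    exact hu m (congrArg (fun s : inputEdges network.E => s.1.1) hm).symm
  · rintro ⟨⟨t, _⟩, ht⟩ rfl
    exact h t ht

theorem apply_eq_of_hub (hφ : network.IsNetworkCode φ) {m : Msg} {w : Node}
    (he : (.hub m, w) ∈ network.E) (h : v (inputEdge m) = v' (inputEdge m)) :
    φ ⟨(.hub m, w), he⟩ v = φ ⟨(.hub m, w), he⟩ v' := by
  refine apply_eq_of_parents hφ he (by simp) fun t ht => ?_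
  have hadj := (mem_edges _ _).1 ht
  cases t with
  | src m' =>
    obtain rfl : m' = m := by simpa [adj] using hadj
    exact (hφ.input (inputEdge m') v v').2 h
  | _ => simp [adj] at hadj

theorem apply_eq_of_leave (hφ : network.IsNetworkCode φ) {k : Coder} {w : Node}
    (he : (.leave k, w) ∈ network.E) (h : φ (coderEdge k) v = φ (coderEdge k) v') :
    φ ⟨(.leave k, w), he⟩ v = φ ⟨(.leave k, w), he⟩ v' := by
  refine apply_eq_of_parents hφ he (by simp) fun t ht => ?_
  have hadj := (mem_edges _ _).1 ht
  cases t with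
  | enter k' =>
    obtain rfl : k' = k := by simpa [adj] using hadj
    exact h
  | _ => simp [adj] at hadj

theorem isCoderCode_of_isNetworkCode (hφ : network.IsNetworkCode φ) :
    IsCoderCode fun k (v : Msg → A) => φ (coderEdge k) (v ∘ inputEquiv.symm) where
  coding k v v' hm hk := by
    refine apply_eq_of_parents hφ _ (by simp) fun t ht => ?_
    have hadj := (mem_edges _ _).1 ht
    cases t with
    | hub m =>
      refine apply_eq_of_hub hφ ht ?_
      simpa [inputEquiv_symm_inputEdge] using hm m (by simpa [adj] using hadj)
    | leave k' => exact apply_eq_of_leave hφ ht (hk k' (by simpa [adj] using hadj))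
    | _ => simp [adj] at hadj
  decoding r v v' hm hk := by
    have hout : φ (network.ofOutput (outputEdge r)) (v ∘ inputEquiv.symm) =
        φ (network.ofOutput (outputEdge r)) (v' ∘ inputEquiv.symm) := by
      refine apply_eq_of_parents hφ _ (by simp) fun t ht => ?_
      have hadj := (mem_edges _ _).1 ht
      cases t with
      | hub m =>
        refine apply_eq_of_hub hφ ht ?_
        simpa [inputEquiv_symm_inputEdge] using hm m (by simpa [adj] using hadj)
      | leave k => exact apply_eq_of_leave hφ ht (hk k (by simpa [adj] using hadj))
      | _ => simp [adj] at hadj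
    rw [← inputEquiv_symm_inputEdge r.demand]
    exact hφ.output (outputEdge r) _ _ hout

end OfNetworkCode

/-! ### A non-linear network code over an alphabet of size four -/

/-- The exchange of the two binary digits. -/
def swapBits : Fin 4 → Fin 4 := ![0, 2, 1, 3]

/-- The symbols of a network code over four letters. The Fano part adds in `(ℤ/2)²`; the non-Fano
part adds in `ℤ/4`, with the digits of `c` exchanged in the second block. -/
def symbol (k : Coder) (v : Msg → Fin 4) : Fin 4 :=
  match k with
  | .w => v .a ^^^ v .b
  | .x => v .b ^^^ v .c
  | .y => v .a ^^^ (v .b ^^^ v .c)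
  | .z => (v .a ^^^ v .b) ^^^ (v .b ^^^ v .c)
  | .pabc => v .a + v .b + v .c
  | .pab => v .a + v .b
  | .pac => v .a + v .c
  | .pbc => v .b + v .c
  | .qcde => swapBits (v .c) + v .d + v .e
  | .qde => v .d + v .e
  | .qcd => swapBits (v .c) + v .d
  | .qce => swapBits (v .c) + v .e

theorem swapBits_injective : Function.Injective swapBits := by decide

theorem eq_of_add_self_eq_of_swapBits : ∀ i j : Fin 4, i + i = j + j →
    swapBits i + swapBits i = swapBits j + swapBits j → i = j := by decide

open Fin.CommRing in
theorem symbol_decoding (r : Receiver) (v v' : Msg → Fin 4) (hm : ∀ m ∈ r.msgs, v m = v' m)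
    (hk : ∀ k ∈ r.coders, symbol k v = symbol k v') : v r.demand = v' r.demand := by
  have decode_f₁ : ∀ a b c : Fin 4, (a ^^^ b) ^^^ (a ^^^ (b ^^^ c)) = c := by decide
  have decode_f₂ : ∀ a b c : Fin 4, (a ^^^ (b ^^^ c)) ^^^ ((a ^^^ b) ^^^ (b ^^^ c)) = b := by
    decide
  have decode_f₃ : ∀ a b c : Fin 4, ((a ^^^ b) ^^^ (b ^^^ c)) ^^^ c = a := by decide
  cases r <;>
    simp only [Receiver.coders, Receiver.msgs, Finset.mem_insert, Finset.mem_singleton,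
      forall_eq_or_imp, forall_eq, symbol, Finset.notMem_empty] at hm hk <;>
    simp only [Receiver.demand]
  case f₁ => rw [← decode_f₁ (v .a) (v .b) (v .c), hk.1, hk.2, decode_f₁]
  case f₂ => rw [← decode_f₂ (v .a) (v .b) (v .c), hk.1, hk.2, decode_f₂]
  case f₃ => rw [← decode_f₃ (v .a) (v .b) (v .c), hk, hm, decode_f₃]
  case q₁ => exact swapBits_injective (by linear_combination hk.1 - hk.2)
  case last =>
    obtain ⟨hab, hac, hbc, hde, hcd, hce⟩ := hk
    have hdouble : v .c + v .c = v' .c + v' .c := by linear_combination hac + hbc - hab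
    have hdouble_swap : swapBits (v .c) + swapBits (v .c) =
        swapBits (v' .c) + swapBits (v' .c) := by linear_combination hcd + hce - hde
    exact eq_of_add_self_eq_of_swapBits _ _ hdouble hdouble_swap
  all_goals linear_combination hk.1 - hk.2

theorem isCoderCode_symbol : IsCoderCode symbol where
  coding k v v' hm hk := by cases k <;> simp_all [Coder.msgs, Coder.coders, symbol]
  decoding := symbol_decoding

/-! ### No linear network code in characteristic two -/

section Linear

variable {K W : Type*} [DivisionRing K] [AddCommGroup W] [Module K W] [FiniteDimensional K W]
  {P : Coder → (Msg → W) →ₗ[K] W}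

theorem IsCoderCode.dependsOn {σ : Coder → (Msg → A) → A} (hσ : IsCoderCode σ) {k : Coder}
    (hk : k.coders = ∅) : DependsOn (σ k) (k.msgs : Set Msg) := fun v v' h =>
  hσ.coding k v v' h (by simp [hk])

theorem IsCoderCode.exists_block_eq_zero (hP : IsCoderCode fun k => P k) {full : Coder}
    {pair : Msg → Coder} (hcard : (full.msgs.card : K) = 1) (hfull : full.msgs.Nontrivial)
    (hfull_coders : full.coders = ∅)
    (hpair : ∀ m ∈ full.msgs, (pair m).coders = ∅ ∧ m ∉ (pair m).msgs)
    (hrcv : ∀ m ∈ full.msgs, ∃ r : Receiver,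
      r.demand = m ∧ r.msgs = ∅ ∧ r.coders = {full, pair m}) (m₀ : Msg) (w : W) :
    ∃ v : Msg → W, v m₀ = w ∧ ∀ m ∈ full.msgs, P (pair m) v = 0 := by
  refine exists_apply_eq_forall_eq_zero (ψ := fun m => P (pair m)) hcard hfull
    (hP.dependsOn hfull_coders) (fun m hm w => ?_) (fun m hm v hv hv' => ?_) m₀ w
  · rw [← map_zero (P (pair m))]
    refine hP.dependsOn (hpair m hm).1 fun m' hm' => ?_
    have hne : m' ≠ m := fun h => (hpair m hm).2 (h ▸ hm')
    rw [Pi.single_eq_of_ne hne, Pi.zero_apply]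
  · obtain ⟨r, rfl, hr_msgs, hr_coders⟩ := hrcv m hm
    exact hP.decoding r v 0 (by simp [hr_msgs]) (by simp [hr_coders, hv, hv'])

theorem not_isCoderCode_linear [CharP K 2] [Nontrivial W] : ¬ IsCoderCode fun k => P k := by
  intro hP
  obtain ⟨w, hw⟩ := exists_ne (0 : W)
  have three_eq_one : ((3 : ℕ) : K) = 1 := by rw [CharTwo.natCast_eq_ite, if_neg (by decide)]
  obtain ⟨v, hvc, hv⟩ := hP.exists_block_eq_zero (full := .pabc)
    (pair := fun | .a => .pbc | .b => .pac | _ => .pab) three_eq_one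
    (by decide) (by decide) (by decide) (by decide) .c w
  obtain ⟨v', hvc', hv'⟩ := hP.exists_block_eq_zero (full := .qcde)
    (pair := fun | .d => .qce | .e => .qcd | _ => .qde) three_eq_one
    (by decide) (by decide) (by decide) (by decide) .c w
  let u := Coder.pabc.msgs.piecewise v v'
  have hu (m) (hm : m ∈ Coder.pabc.msgs) : u m = v m := Finset.piecewise_eq_of_mem _ _ _ hm
  have hu' (m) (hm : m ∈ Coder.qcde.msgs) : u m = v' m := by
    by_cases hmc : m = .c
    · rw [hmc, hu .c (by decide), hvc, hvc']
    · exact Finset.piecewise_eq_of_notMem _ _ _ (by revert m; decide)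
  have last_eq_zero : ∀ k ∈ Receiver.last.coders, P k u = 0 := by
    have on_first_block {k : Coder} (hk : k.coders = ∅) (hsub : k.msgs ⊆ Coder.pabc.msgs) :
        P k u = P k v := hP.dependsOn hk fun m hm => hu m (hsub hm)
    have on_second_block {k : Coder} (hk : k.coders = ∅) (hsub : k.msgs ⊆ Coder.qcde.msgs) :
        P k u = P k v' := hP.dependsOn hk fun m hm => hu' m (hsub hm)
    simp only [Receiver.coders, Finset.mem_insert, Finset.mem_singleton, forall_eq_or_imp,
      forall_eq]
    exact ⟨(on_first_block rfl (by decide)).trans (hv .c (by decide)),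
      (on_first_block rfl (by decide)).trans (hv .b (by decide)),
      (on_first_block rfl (by decide)).trans (hv .a (by decide)),
      (on_second_block rfl (by decide)).trans (hv' .c (by decide)),
      (on_second_block rfl (by decide)).trans (hv' .e (by decide)),
      (on_second_block rfl (by decide)).trans (hv' .d (by decide))⟩
  have huc : u .c = 0 := hP.decoding .last u 0 (by simp [Receiver.msgs])
    fun k hk => by rw [last_eq_zero k hk, map_zero]
  exact hw (by rw [← hvc, ← hu .c (by decide), huc])

theorem not_isNetworkCode_linear {n : ℕ} (hn : 0 < n) {F : Type*} [Field F] [CharP F 2]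
    (φ : network.E → (inputEdges network.E → Fin n → F) →ₗ[F] (Fin n → F)) :
    ¬ network.IsNetworkCode fun e => φ e := fun hφ =>
  have : Nonempty (Fin n) := ⟨⟨0, hn⟩⟩
  not_isCoderCode_linear (P := fun k =>
    φ (coderEdge k) ∘ₗ LinearMap.funLeft F (Fin n → F) inputEquiv.symm)
    (isCoderCode_of_isNetworkCode hφ)

end Linear

end DFZ

end IndexCoding

open IndexCoding IndexCoding.DFZ in
theorem corollary17_general {n : ℕ} (hn : 0 < n) (F : Type*) [Field F] [CharP F 2] :
    network.indexInstance.rate n 4 = (network.indexInstance.mu : ℚ) ∧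
      (network.indexInstance.mu : ℚ) < network.indexInstance.linearRate n F := by
  have hcode := isCoderCode_symbol.isNetworkCode.pi (ι := Fin n)
  refine ⟨hcode.rate_eq_mu hn, ?_⟩
  rw [hcode.mu_eq_card_edges hn]
  exact network.card_edges_lt_linearRate hn (not_isNetworkCode_linear hn)

theorem corollary17 (F : Type*) [Field F] [Fintype F] (hF : Fintype.card F = 4) :
    IndexCoding.DFZ.network.indexInstance.rate 2 4 =
        (IndexCoding.DFZ.network.indexInstance.mu : ℚ) ∧
      (IndexCoding.DFZ.network.indexInstance.mu : ℚ) <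
        IndexCoding.DFZ.network.indexInstance.linearRate 2 F :=
  have : CharP F 2 := charP_of_card_eq_prime_pow (f := 2) hF
  corollary17_general two_pos F
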